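/- For a finite real vector $v$ let $S(v)$ be the number of sign changes in $v$ after all zero entries are deleted ($S(0)=0$). For a real function $f$ on a linearly ordered set (vectors, sequences, signals on a real interval) put $S(f)=\sup\{S(f(t_1),\dots,f(t_m)) : t_1<\dots<t_m\}\in\mathbb{N}\cup\{\infty\}$. A nonzero $f$ with $S(f)<\infty$ has a well-defined leading sign $\sigma$: there is $t$ with $f(t)\neq0$ such that $f(t)$ and all nonzero values $f(s)$, $s<t$, have sign $\sigma$; for vectors and sequences this is the sign of the first nonzero entry. A linear map $X$ is $\mathrm{OVD}_{k}$ if for every $u$ in its domain with $S(u)\le k$ one has $S(Xu)\le S(u)$, and, whenever $S(Xu)=S(u)$, the leading signs of $u$ and $Xu$ (if both exist) coincide. Let $A\in\mathbb{R}^{n\times n}$, $b,c^{\mathsf T}\in\mathbb{R}^n$ and $1\le k\le\infty$. * The discrete-time (DT) system $(A,b,c)$ is called internally Hankel $k$-positive if the following three maps are $\mathrm{OVD}_{k-1}$: $x\mapsto Ax$ on $\mathbb{R}^n$; $\mathcal{C}u=\sum_{t=-\infty}^{-1}A^{-t-1}b\,u(t)$, on all bounded $u$ for which the series converges absolutely;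 and $(\mathcal{O}x_0)(t)=cA^tx_0$, $t=0,1,2,\dots$, on $\mathbb{R}^n$. * The continuous-time (CT) system $(A,b,c)$ is called CT internally Hankel $k$-positive if the following maps are $\mathrm{OVD}_{k-1}$: $x\mapsto e^{At}x$ on $\mathbb{R}^n$ for every $t\ge0$; $\mathcal{C}u=\int_{-\infty}^{0}e^{-A\tau}b\,u(\tau)\,d\tau$, on all bounded measurable $u:(-\infty,0)\to\mathbb{R}$ for which the integral converges absolutely; and $(\mathcal{O}x_0)(t)=ce^{At}x_0$, $t\ge0$, on $\mathbb{R}^n$. In both cases past inputs are ordered by increasing lag, i.e. as $u(-1),u(-2),\dots$, respectively as $s\mapsto u(-s)$, $s>0$. (If $A$ is stable, the convergence conditions hold for all bounded inputs.) Lemma. The CT system $(A,b,c)$ is CT internally Hankel $k$-positive if and only if there is an $\varepsilon>0$ such that the DT system $(e^{Ah},b,c)$ is internally Hankel $k$-positive for all $h\in(0,\varepsilon)$. -/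

import Mathlib

open MeasureTheory
open scoped Matrix

/-- The variation of a finite real vector: delete all zeros, then count the pairs of consecutive
entries with opposite signs. -/
noncomputable def signChanges (l : List ℝ) : ℕ :=
  ((l.filter (fun x => x ≠ 0)).zip (l.filter (fun x => x ≠ 0)).tail).countP
    (fun p => p.1 * p.2 < 0)

/-- The variation of a real function on a linearly ordered index set: the supremum of the
variations of the vectors `(f t₁, …, f tₘ)` with `t₁ < ⋯ < tₘ`. For vectors (`ι = Fin n`) and
sequences (`ι = ℕ`) this is the number of sign changes after deleting the zeros (deleting further
entries never increases that number). -/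
noncomputable def variation {ι : Type*} [LinearOrder ι] (f : ι → ℝ) : ℕ∞ :=
  ⨆ (m : ℕ) (t : Fin m → ι) (_ : StrictMono t),
    (signChanges (List.ofFn (fun i => f (t i))) : ℕ∞)

/-- `σ` is the sign of the first nonzero values of `f`: `f` has sign `σ` at some `t`, and all
nonzero values of `f` before `t` have sign `σ` as well. Such a `σ` is unique. For vectors and
sequences it is the sign of the first nonzero entry; a function on a real interval need not have a
first nonzero value, but a nonzero function of finite variation always has a leading sign. -/
def HasLeadingSign {ι : Type*} [LinearOrder ι] (f : ι → ℝ) (σ : SignType) : Prop :=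
  ∃ t, f t ≠ 0 ∧ SignType.sign (f t) = σ ∧ ∀ s < t, f s ≠ 0 → SignType.sign (f s) = σ

/-- The map `X` with domain `D` is order-preserving `k`-variation diminishing (`OVD_k`): for every
`u ∈ D` of variation at most `k`, the variation of `X u` is at most that of `u`, and in case of
equality the first nonzero values of `u` and `X u` (if there are any) have the same sign. -/
def IsOVD {ι κ : Type*} [LinearOrder ι] [LinearOrder κ] (k : ℕ∞) (D : Set (ι → ℝ))
    (X : (ι → ℝ) → (κ → ℝ)) : Prop :=
  ∀ u ∈ D, variation u ≤ k →
    variation (X u) ≤ variation u ∧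
    (variation (X u) = variation u →
      ∀ σ τ : SignType, HasLeadingSign u σ → HasLeadingSign (X u) τ → σ = τ)

/-! ### Discrete time

Past inputs are listed by increasing lag, i.e. in the order `u(-1), u(-2), …`: the entry `u i` is
the input at time `-(i + 1)`. -/

/-- Bounded past inputs for which the controllability series converges (all bounded inputs if
`A` is Schur stable). -/
def dtInputs {n : ℕ} (A : Matrix (Fin n) (Fin n) ℝ) (b : Fin n → ℝ) : Set (ℕ → ℝ) :=
  {u | (∃ M : ℝ, ∀ i, |u i| ≤ M) ∧ Summable (fun i => u i • ((A ^ i) *ᵥ b))}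

/-- Controllability operator `u ↦ ∑_{t ≤ -1} A^(-t-1) b u(t)`. -/
noncomputable def dtCon {n : ℕ} (A : Matrix (Fin n) (Fin n) ℝ) (b : Fin n → ℝ)
    (u : ℕ → ℝ) : Fin n → ℝ :=
  ∑' i, u i • ((A ^ i) *ᵥ b)

/-- Observability operator `x₀ ↦ (c A^t x₀)_{t ≥ 0}`. -/
def dtObs {n : ℕ} (A : Matrix (Fin n) (Fin n) ℝ) (c : Fin n → ℝ)
    (x₀ : Fin n → ℝ) : ℕ → ℝ :=
  fun t => c ⬝ᵥ ((A ^ t) *ᵥ x₀)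

/-- Internal Hankel `k`-positivity of the discrete-time system `(A, b, c)`; `k = ⊤` is internal
Hankel total positivity. -/
def DTInternallyHankelPositive {n : ℕ} (k : ℕ∞) (A : Matrix (Fin n) (Fin n) ℝ)
    (b c : Fin n → ℝ) : Prop :=
  IsOVD (k - 1) Set.univ (fun x : Fin n → ℝ => A *ᵥ x) ∧
  IsOVD (k - 1) (dtInputs A b) (dtCon A b) ∧
  IsOVD (k - 1) Set.univ (dtObs A c)

/-! ### Continuous time

Past inputs are again listed by increasing lag: `u s`, for `s > 0`, is the input at time `-s`. -/

/-- Lebesgue measure on `(0, ∞)`. -/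
noncomputable def lagMeasure : Measure (Set.Ioi (0 : ℝ)) :=
  Measure.comap Subtype.val volume

/-- Bounded measurable past inputs for which the controllability integral converges (all bounded
measurable inputs if `A` is Hurwitz stable). -/
def ctInputs {n : ℕ} (A : Matrix (Fin n) (Fin n) ℝ) (b : Fin n → ℝ) :
    Set (Set.Ioi (0 : ℝ) → ℝ) :=
  {u | Measurable u ∧ (∃ M : ℝ, ∀ s, |u s| ≤ M) ∧
    Integrable (fun s => u s • (NormedSpace.exp ((s : ℝ) • A) *ᵥ b)) lagMeasure}

/-- Controllability operator `u ↦ ∫_{τ < 0} e^{-Aτ} b u(τ) dτ`, written in the lag `s = -τ`. -/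
noncomputable def ctCon {n : ℕ} (A : Matrix (Fin n) (Fin n) ℝ) (b : Fin n → ℝ)
    (u : Set.Ioi (0 : ℝ) → ℝ) : Fin n → ℝ :=
  ∫ s, u s • (NormedSpace.exp ((s : ℝ) • A) *ᵥ b) ∂lagMeasure

/-- Observability operator `x₀ ↦ (c e^{At} x₀)_{t ≥ 0}`. -/
noncomputable def ctObs {n : ℕ} (A : Matrix (Fin n) (Fin n) ℝ) (c : Fin n → ℝ)
    (x₀ : Fin n → ℝ) : Set.Ici (0 : ℝ) → ℝ :=
  fun t => c ⬝ᵥ (NormedSpace.exp ((t : ℝ) • A) *ᵥ x₀)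

/-- Internal Hankel `k`-positivity of the continuous-time system `(A, b, c)`; `k = ⊤` is internal
Hankel total positivity. -/
def CTInternallyHankelPositive {n : ℕ} (k : ℕ∞) (A : Matrix (Fin n) (Fin n) ℝ)
    (b c : Fin n → ℝ) : Prop :=
  (∀ t : ℝ, 0 ≤ t →
    IsOVD (k - 1) Set.univ (fun x : Fin n → ℝ => NormedSpace.exp (t • A) *ᵥ x)) ∧
  IsOVD (k - 1) (ctInputs A b) (ctCon A b) ∧
  IsOVD (k - 1) Set.univ (ctObs A c)

/-! The order-preserving variation bound amounts to a transfer of sign patterns: for each natural `m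
≤ k` and each `u` with `S(u) ≤ m`, a pattern of `m` alternations in `Xu` must occur in `u` with the
same first sign (`isOVD_iff_alternates`). A pattern is a finite set of strict inequalities, so it
survives passage from a limit to its approximants, and it can be carried along monotone changes of
the time variable.

From continuous to discrete time, the observability sequence is a restriction to the grid `hℕ`. For
controllability, the input series is truncated and each sample is replaced by a short pulse of unit
area; as the width tends to zero the reached states converge (`isOVD_dtCon_of_ctCon`).

From discrete to continuous time, `e^{At}` is a power of `e^{At/N}` with `t/N < ε`. Observability
follows by sampling at `⌊t/h⌋ h → t`. For controllability, the integrals of `u` over cells of length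
`h` form a discrete input with no new sign patterns, and dominated convergence recovers the
continuous state as `h → 0` (`isOVD_ctCon_of_dtCon`). -/

/-! ### Alternating chains and variation. -/

/-- `f` takes alternating signs, starting with `σ`, along some chain of `m + 1` points whose first
point is `t`. -/
def AlternatesFrom {ι : Type*} [LinearOrder ι] (f : ι → ℝ) : ℕ → SignType → ι → Prop
  | 0, σ, t => SignType.sign (f t) = σ
  | m + 1, σ, t => SignType.sign (f t) = σ ∧ ∃ s, t < s ∧ AlternatesFrom f m (-σ) s

/-- `f` takes alternating nonzero signs, starting with `σ`, along some chain of `m + 1` points. -/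
def Alternates {ι : Type*} [LinearOrder ι] (f : ι → ℝ) (m : ℕ) (σ : SignType) : Prop :=
  σ ≠ 0 ∧ ∃ t, AlternatesFrom f m σ t

theorem signChanges_map {ι : Type*} (f : ι → ℝ) (l : List ι) :
    signChanges (l.map f) = ((((l.filter (fun x => f x ≠ 0)).map f).zip
      ((l.filter (fun x => f x ≠ 0)).tail.map f)).countP (fun p => p.1 * p.2 < 0)) := by
  unfold signChanges
  rw [List.filter_map, List.map_tail]
  rfl

section Alternation

variable {ι κ : Type*} [LinearOrder ι] [LinearOrder κ] {f : ι → ℝ} {g : κ → ℝ} {m : ℕ}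
  {σ τ : SignType} {s t : ι}

theorem SignType.eq_neg_of_ne (hσ : σ ≠ 0) (hτ : τ ≠ 0) (h : σ ≠ τ) : σ = -τ := by
  revert σ τ; decide

theorem SignType.neg_ne_zero_of_ne (hσ : σ ≠ 0) : -σ ≠ 0 := by
  revert σ; decide

theorem SignType.ne_neg_self (hσ : σ ≠ 0) : σ ≠ -σ := by
  revert σ; decide

theorem AlternatesFrom.sign_eq (h : AlternatesFrom f m σ t) : SignType.sign (f t) = σ := by
  cases m with
  | zero => exact h
  | succ m => exact h.1

theorem AlternatesFrom.of_lt (hst : s < t) (hs : SignType.sign (f s) = σ)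
    (h : AlternatesFrom f m σ t) : AlternatesFrom f m σ s := by
  cases m with
  | zero => exact hs
  | succ m =>
    obtain ⟨-, r, hr, h⟩ := h
    exact ⟨hs, r, hst.trans hr, h⟩

theorem AlternatesFrom.of_succ (h : AlternatesFrom f (m + 1) σ t) : AlternatesFrom f m σ t := by
  induction m generalizing σ t with
  | zero => exact h.1
  | succ m ih =>
    obtain ⟨h, r, hr, h'⟩ := h
    exact ⟨h, r, hr, ih h'⟩

theorem Alternates.of_succ (h : Alternates f (m + 1) σ) : Alternates f m σ :=
  ⟨h.1, h.2.imp fun _ => AlternatesFrom.of_succ⟩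

theorem Alternates.neg_of_succ (h : Alternates f (m + 1) σ) : Alternates f m (-σ) := by
  obtain ⟨hσ, t, -, s, -, h⟩ := h
  exact ⟨SignType.neg_ne_zero_of_ne hσ, s, h⟩

/-- Whichever chain starts first lends its starting point to the other as a new first point; a
common starting point would have two opposite signs. -/
theorem Alternates.exists_succ (h : Alternates f m σ) (h' : Alternates f m (-σ)) :
    ∃ τ, Alternates f (m + 1) τ := by
  obtain ⟨hσ, t, h⟩ := h
  obtain ⟨hσ', s, h'⟩ := h'
  rcases lt_trichotomy s t with hst | rfl | hst
  · exact ⟨-σ, hσ', s, h'.sign_eq, t, hst, by rwa [neg_neg]⟩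
  · have := h.sign_eq.symm.trans h'.sign_eq
    exact absurd this (SignType.ne_neg_self hσ)
  · exact ⟨σ, hσ, t, h.sign_eq, s, hst, h'⟩

/-- Strict monotonicity is not needed: consecutive points of a chain have images where `f` has
opposite signs, so these images cannot coincide. -/
theorem AlternatesFrom.map {φ : κ → ι} (hφ : Monotone φ)
    (hs : ∀ j, g j ≠ 0 → SignType.sign (f (φ j)) = SignType.sign (g j)) {t : κ} (hσ : σ ≠ 0)
    (h : AlternatesFrom g m σ t) : AlternatesFrom f m σ (φ t) := by
  have key : ∀ {σ : SignType} {t : κ}, σ ≠ 0 → SignType.sign (g t) = σ →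
      SignType.sign (f (φ t)) = σ := by
    intro σ t hσ h
    rw [hs t, h]
    rintro h0
    rw [h0, sign_zero] at h
    exact hσ h.symm
  induction m generalizing σ t with
  | zero => exact key hσ h
  | succ m ih =>
    obtain ⟨h, r, hr, h'⟩ := h
    have hσ' : -σ ≠ 0 := SignType.neg_ne_zero_of_ne hσ
    refine ⟨key hσ h, φ r, lt_of_le_of_ne (hφ hr.le) fun he => ?_, ih hσ' h'⟩
    have h1 := key hσ h
    have h2 := key hσ' h'.sign_eq
    exact SignType.ne_neg_self hσ (h1.symm.trans (he ▸ h2))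

theorem Alternates.map {φ : κ → ι} (hφ : Monotone φ)
    (hs : ∀ j, g j ≠ 0 → SignType.sign (f (φ j)) = SignType.sign (g j))
    (h : Alternates g m σ) : Alternates f m σ :=
  ⟨h.1, h.2.elim fun t ht => ⟨φ t, ht.map hφ hs h.1⟩⟩

/-- Sign changes counted between consecutive entries, for lists without zero entries. -/
theorem alternatesFrom_countP {l : List ι} (hl : (t :: l).Pairwise (· < ·))
    (h0 : ∀ s ∈ t :: l, f s ≠ 0) :
    AlternatesFrom f ((((t :: l).map f).zip (l.map f)).countP (fun p => p.1 * p.2 < 0))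
      (SignType.sign (f t)) t := by
  induction l generalizing t with
  | nil => simp [AlternatesFrom]
  | cons s l ih =>
    have h := ih (List.pairwise_cons.1 hl).2 fun r hr => h0 r (List.mem_cons_of_mem _ hr)
    have hts : t < s := (List.pairwise_cons.1 hl).1 s (by simp)
    have ht := h0 t (by simp)
    have hs := h0 s (by simp)
    rw [List.map_cons, List.map_cons, List.zip_cons_cons, List.countP_cons]
    rw [List.map_cons] at h
    by_cases hneg : f t * f s < 0
    · have hsg : SignType.sign (f s) = -SignType.sign (f t) := by
        rcases mul_neg_iff.1 hneg with ⟨h1, h2⟩ | ⟨h1, h2⟩ <;> simp [h1, h2]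
      rw [if_pos (by simpa using hneg)]
      exact ⟨rfl, s, hts, hsg ▸ h⟩
    · have hsg : SignType.sign (f s) = SignType.sign (f t) := by
        rcases lt_or_gt_of_ne ht with h1 | h1 <;> rcases lt_or_gt_of_ne hs with h2 | h2 <;>
          simp [h1, h2] <;> exact hneg (by nlinarith)
      rw [if_neg (by simpa using hneg), add_zero]
      exact AlternatesFrom.of_lt hts rfl (hsg ▸ h)

theorem AlternatesFrom.exists_list (h : AlternatesFrom f m σ t) (hσ : σ ≠ 0) :
    ∃ l : List ι, (t :: l).Pairwise (· < ·) ∧ (∀ s ∈ t :: l, f s ≠ 0) ∧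
      (((t :: l).map f).zip (l.map f)).countP (fun p => p.1 * p.2 < 0) = m := by
  have key : ∀ {σ : SignType} {t : ι}, σ ≠ 0 → SignType.sign (f t) = σ → f t ≠ 0 := by
    rintro σ t hσ h h0
    rw [h0, sign_zero] at h
    exact hσ h.symm
  induction m generalizing σ t with
  | zero => exact ⟨[], by simp, by simpa using key hσ h, by simp⟩
  | succ m ih =>
    obtain ⟨h, s, hts, h'⟩ := h
    have hσ' : -σ ≠ 0 := SignType.neg_ne_zero_of_ne hσ
    obtain ⟨l, h1, h2, h3⟩ := ih h' hσ'
    refine ⟨s :: l, ?_, ?_, ?_⟩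
    · refine List.pairwise_cons.2 ⟨fun r hr => ?_, h1⟩
      rcases List.mem_cons.1 hr with rfl | hr
      · exact hts
      · exact hts.trans ((List.pairwise_cons.1 h1).1 r hr)
    · intro r hr
      rcases List.mem_cons.1 hr with rfl | hr
      · exact key hσ h
      · exact h2 r hr
    · have hneg : f t * f s < 0 := by
        have hs := h'.sign_eq
        have ht := key hσ h
        have hs0 := key hσ' hs
        rw [← h] at hs
        rcases lt_or_gt_of_ne ht with h1 | h1 <;> rcases lt_or_gt_of_ne hs0 with h2 | h2 <;>
          simp [h1, h2] at hs <;> nlinarith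
      rw [List.map_cons, List.map_cons, List.zip_cons_cons, List.countP_cons,
        if_pos (by simpa using hneg), ← h3, List.map_cons]

theorem lt_variation_iff : (m : ℕ∞) < variation f ↔ ∃ σ, Alternates f (m + 1) σ := by
  constructor
  · intro h
    simp only [variation, lt_iSup_iff] at h
    obtain ⟨N, t, ht, h⟩ := h
    have e : List.ofFn (fun i => f (t i)) = (List.ofFn t).map f := by
      rw [List.map_ofFn]; rfl
    rw [e, signChanges_map, Nat.cast_lt] at h
    have hp : ((List.ofFn t).filter (fun x => f x ≠ 0)).Pairwise (· < ·) :=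
      List.Pairwise.filter _ (List.pairwise_ofFn.2 fun i j hij => ht hij)
    have h0 : ∀ s ∈ (List.ofFn t).filter (fun x => f x ≠ 0), f s ≠ 0 := fun s hs => by
      simpa using (List.mem_filter.1 hs).2
    generalize (List.ofFn t).filter (fun x => f x ≠ 0) = l at h hp h0
    cases l with
    | nil => simp at h
    | cons a l =>
      rw [List.tail_cons] at h
      have h1 := alternatesFrom_countP hp h0
      generalize List.countP _ _ = N at h h1
      have hne : SignType.sign (f a) ≠ 0 := sign_ne_zero.2 (h0 a (by simp))
      refine ⟨_, hne, a, ?_⟩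
      -- The chain found has `N > m` sign changes; dropping last points shortens it to `m + 1`.
      exact Nat.le_induction (m := m + 1)
        (P := fun N _ => AlternatesFrom f N _ a → AlternatesFrom f (m + 1) _ a)
        id (fun N _ ih h => ih h.of_succ) N h h1
  · rintro ⟨σ, hσ, t, h⟩
    obtain ⟨l, h1, h2, h3⟩ := h.exists_list hσ
    have hf : (t :: l).filter (fun x => f x ≠ 0) = t :: l :=
      List.filter_eq_self.2 fun s hs => by simpa using h2 s hs
    have e : List.ofFn (fun i => f ((t :: l).get i)) = (t :: l).map f := by
      conv_rhs => rw [← List.ofFn_get (t :: l), List.map_ofFn]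
      rfl
    have hle : ((signChanges (List.ofFn (fun i => f ((t :: l).get i))) : ℕ) : ℕ∞)
        ≤ variation f :=
      le_iSup₂_of_le (t :: l).length (t :: l).get
        (le_iSup_of_le (List.sortedLT_iff_strictMono_get.1 h1.sortedLT) le_rfl)
    rw [e, signChanges_map, hf, List.tail_cons, h3] at hle
    exact lt_of_lt_of_le (by exact_mod_cast Nat.lt_succ_self m) hle

theorem variation_le_iff : variation f ≤ m ↔ ∀ σ, ¬ Alternates f (m + 1) σ := by
  rw [← not_lt, lt_variation_iff, not_exists]

theorem Alternates.le_variation (h : Alternates f m σ) : (m : ℕ∞) ≤ variation f := by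
  cases m with
  | zero => simp
  | succ m =>
    have := lt_variation_iff.2 ⟨σ, h⟩
    push_cast
    exact Order.add_one_le_of_lt this

theorem exists_alternates (h : (m : ℕ∞) ≤ variation f) (hf : f ≠ 0) :
    ∃ σ, Alternates f m σ := by
  cases m with
  | zero =>
    obtain ⟨t, ht⟩ := Function.ne_iff.1 hf
    exact ⟨_, sign_ne_zero.2 ht, t, rfl⟩
  | succ m =>
    refine lt_variation_iff.1 (lt_of_lt_of_le ?_ h)
    exact_mod_cast Nat.lt_succ_self m

theorem Alternates.hasLeadingSign (h : Alternates f m σ) (hf : variation f ≤ m) :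
    HasLeadingSign f σ := by
  obtain ⟨hσ, t, h⟩ := h
  refine ⟨t, fun h0 => hσ ?_, h.sign_eq, fun s hs h0 => ?_⟩
  · rw [← h.sign_eq, h0, sign_zero]
  -- An earlier nonzero value of the other sign would prolong the chain beyond the variation.
  · by_contra hne
    have hs' := SignType.eq_neg_of_ne (sign_ne_zero.2 h0) hσ hne
    refine variation_le_iff.1 hf (-σ) ⟨SignType.neg_ne_zero_of_ne hσ, s, hs', t, hs, ?_⟩
    rwa [neg_neg]

theorem HasLeadingSign.unique (h : HasLeadingSign f σ) (h' : HasLeadingSign f τ) : σ = τ := by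
  obtain ⟨t, h0, h1, h2⟩ := h
  obtain ⟨t', h0', h1', h2'⟩ := h'
  rcases lt_trichotomy t t' with h | rfl | h
  · exact h1.symm.trans (h2' t h h0)
  · exact h1.symm.trans h1'
  · exact (h2 t' h h0').symm.trans h1'

/-- Variation bound and sign condition merge into one statement that passes to limits. Conversely,
if `Xu` had one alternation too many, it would have `m`-fold patterns with both starting signs; both
transfer to `u`, where they combine into a pattern that is too long. `hfin` disposes of inputs of
infinite variation, which are admitted when `k = ⊤`. -/
theorem isOVD_iff_alternates {k : ℕ∞} {D : Set (ι → ℝ)} {X : (ι → ℝ) → (κ → ℝ)} (h0 : X 0 = 0)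
    (hfin : ∀ u, variation u = ⊤ → variation (X u) ≠ ⊤) :
    IsOVD k D X ↔ ∀ u ∈ D, ∀ m : ℕ, (m : ℕ∞) ≤ k → variation u ≤ m → ∀ σ,
      Alternates (X u) m σ → Alternates u m σ := by
  constructor
  · intro H u hu m hm hum σ hX
    obtain ⟨h1, h2⟩ := H u hu (hum.trans hm)
    -- The pattern in `X u` squeezes both variations to exactly `m`, so the sign clause applies.
    have heq : variation (X u) = variation u := le_antisymm h1 (hum.trans hX.le_variation)
    have hu0 : u ≠ 0 := by
      rintro rfl
      obtain ⟨hσ, t, ht⟩ := hX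
      apply hσ
      rw [← ht.sign_eq, h0, Pi.zero_apply, sign_zero]
    obtain ⟨τ, hτ⟩ := exists_alternates (hX.le_variation.trans h1) hu0
    have := h2 heq τ σ (hτ.hasLeadingSign hum) (hX.hasLeadingSign (h1.trans hum))
    exact this ▸ hτ
  · intro H u hu huk
    rcases eq_or_ne (variation u) ⊤ with htop | htop
    · exact ⟨htop ▸ le_top, fun h => absurd (h.trans htop) (hfin u htop)⟩
    · obtain ⟨m, hm⟩ := ENat.ne_top_iff_exists.1 htop
      have H' := H u hu m (hm ▸ huk) hm.symm.le
      refine ⟨?_, fun heq σ τ hσ hτ => ?_⟩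
      · rw [← hm, variation_le_iff]
        intro σ hσ
        obtain ⟨τ, hτ⟩ := (H' σ hσ.of_succ).exists_succ (H' _ hσ.neg_of_succ)
        exact variation_le_iff.1 hm.symm.le τ hτ
      · have hX0 : X u ≠ 0 := by
          intro h
          obtain ⟨t, ht, -⟩ := hτ
          exact ht (congrFun h t)
        obtain ⟨τ', hτ'⟩ := exists_alternates (m := m) (by rw [hm, heq]) hX0
        have h1 := (hτ'.hasLeadingSign (by rw [hm, heq])).unique hτ
        have h2 := ((H' τ' hτ').hasLeadingSign hm.symm.le).unique hσ
        exact h2.symm.trans h1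

/-- Each step of a chain raises the index by at least one. -/
theorem variation_ne_top_of_fin {n : ℕ} (v : Fin n → ℝ) : variation v ≠ ⊤ := by
  have key : ∀ {m : ℕ} {σ : SignType} {t : Fin n}, AlternatesFrom v m σ t → t.1 + m < n := by
    intro m
    induction m with
    | zero => intro σ t _; simp
    | succ m ih =>
      rintro σ t ⟨-, s, hs, h⟩
      have := ih h
      have : t.1 < s.1 := hs
      omega
  refine ne_top_of_le_ne_top (ENat.natCast_ne_top n) (variation_le_iff.2 ?_)
  rintro σ ⟨-, t, h⟩
  have := key h
  omega

theorem IsOVD.comp {n : ℕ} {k : ℕ∞} {X Y : (Fin n → ℝ) → (Fin n → ℝ)} (hX : IsOVD k Set.univ X)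
    (hY : IsOVD k Set.univ Y) (hX0 : X 0 = 0) (hY0 : Y 0 = 0) :
    IsOVD k Set.univ (fun x => X (Y x)) := by
  have hX' := (isOVD_iff_alternates hX0 fun u h => absurd h (variation_ne_top_of_fin u)).1 hX
  have hY' := (isOVD_iff_alternates hY0 fun u h => absurd h (variation_ne_top_of_fin u)).1 hY
  refine (isOVD_iff_alternates (by simp only [hX0, hY0])
    fun u h => absurd h (variation_ne_top_of_fin u)).2 fun u hu m hm hum σ h => ?_
  exact hY' u hu m hm hum σ
    (hX' (Y u) trivial m hm ((hY u hu (hum.trans hm)).1.trans hum) σ h)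

/-- Alternation passes from a limit to the approximating functions, also when the points of the
chain move with the parameter. -/
theorem AlternatesFrom.eventually {α : Type*} {l : Filter α} {G : α → κ → ℝ} {φ : α → ι → κ}
    (hlt : ∀ s t, s < t → ∀ᶠ a in l, φ a s < φ a t)
    (hG : ∀ t, Filter.Tendsto (fun a => G a (φ a t)) l (nhds (f t)))
    (hσ : σ ≠ 0) (h : AlternatesFrom f m σ t) : ∀ᶠ a in l, AlternatesFrom (G a) m σ (φ a t) := by
  have key : ∀ {σ : SignType} {t : ι}, σ ≠ 0 → SignType.sign (f t) = σ →
      ∀ᶠ a in l, SignType.sign (G a (φ a t)) = σ := by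
    intro σ t hσ h
    rcases lt_trichotomy (f t) 0 with h1 | h1 | h1
    · filter_upwards [(hG t).eventually_lt_const h1] with a ha
      rw [← h, sign_neg ha, sign_neg h1]
    · rw [h1, sign_zero] at h
      exact absurd h.symm hσ
    · filter_upwards [(hG t).eventually_const_lt h1] with a ha
      rw [← h, sign_pos ha, sign_pos h1]
  induction m generalizing σ t with
  | zero => exact key hσ h
  | succ m ih =>
    obtain ⟨h, s, hs, h'⟩ := h
    filter_upwards [key hσ h, hlt t s hs, ih (SignType.neg_ne_zero_of_ne hσ) h'] with a h1 h2 h3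
    exact ⟨h1, φ a s, h2, h3⟩

theorem Alternates.eventually {α : Type*} {l : Filter α} {G : α → ι → ℝ}
    (hG : Filter.Tendsto G l (nhds f)) (h : Alternates f m σ) :
    ∀ᶠ a in l, Alternates (G a) m σ := by
  obtain ⟨hσ, t, h⟩ := h
  filter_upwards [h.eventually (φ := fun _ t => t) (fun s t h => by simp [h])
    (fun t => (tendsto_pi_nhds.1 hG) t) hσ] with a ha
  exact ⟨hσ, t, ha⟩

end Alternation

/-! ### The semigroup `e^{At}`. -/

section MatrixExponential

variable {n : ℕ} (A : Matrix (Fin n) (Fin n) ℝ)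

theorem exp_smul_pow (h : ℝ) (i : ℕ) :
    NormedSpace.exp (h • A) ^ i = NormedSpace.exp (((i : ℝ) * h) • A) := by
  rw [← Matrix.exp_nsmul, ← Nat.cast_smul_eq_nsmul ℝ, smul_smul]

theorem exp_add_smul (s t : ℝ) :
    NormedSpace.exp ((s + t) • A) = NormedSpace.exp (s • A) * NormedSpace.exp (t • A) := by
  rw [add_smul]
  exact Matrix.exp_add_of_commute _ _ (((Commute.refl A).smul_left s).smul_right t)

theorem continuous_exp_smul : Continuous fun t : ℝ => NormedSpace.exp (t • A) := by
  let : NormedRing (Matrix (Fin n) (Fin n) ℝ) := Matrix.linftyOpNormedRing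
  let : NormedAlgebra ℝ (Matrix (Fin n) (Fin n) ℝ) := Matrix.linftyOpNormedAlgebra
  let : NormedAlgebra ℚ (Matrix (Fin n) (Fin n) ℝ) := NormedAlgebra.restrictScalars ℚ ℝ _
  exact NormedSpace.exp_continuous.comp (continuous_id.smul continuous_const)

theorem continuous_exp_smul_mulVec (v : Fin n → ℝ) :
    Continuous fun t : ℝ => NormedSpace.exp (t • A) *ᵥ v :=
  (continuous_exp_smul A).matrix_mulVec continuous_const

theorem exists_norm_exp_neg_smul_mulVec_le :
    ∃ K : ℝ, ∀ r ∈ Set.Icc (0 : ℝ) 1, ∀ v : Fin n → ℝ,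
      ‖NormedSpace.exp ((-r) • A) *ᵥ v‖ ≤ K * ‖v‖ := by
  let : NormedRing (Matrix (Fin n) (Fin n) ℝ) := Matrix.linftyOpNormedRing
  obtain ⟨K, hK⟩ := isCompact_Icc.exists_bound_of_continuousOn (s := Set.Icc (0 : ℝ) 1)
    ((continuous_exp_smul A).comp continuous_neg).continuousOn
  exact ⟨K, fun r hr v => (Matrix.linfty_opNorm_mulVec _ _).trans
    (mul_le_mul_of_nonneg_right (hK r hr) (norm_nonneg v))⟩

end MatrixExponential

/-! ### Rounding times down to a grid. -/

section Sampling

theorem floor_div_mul_mem {h t : ℝ} (hh : 0 < h) (ht : 0 ≤ t) :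
    t - ⌊t / h⌋₊ * h ∈ Set.Icc 0 h := by
  have h1 := Nat.floor_le (div_nonneg ht hh.le)
  have h2 := (Nat.lt_floor_add_one (t / h)).le
  rw [le_div_iff₀ hh] at h1
  rw [div_le_iff₀ hh] at h2
  constructor <;> linarith

theorem tendsto_floor_div_mul {t : ℝ} (ht : 0 ≤ t) :
    Filter.Tendsto (fun h : ℝ => (⌊t / h⌋₊ : ℝ) * h) (nhdsWithin 0 (Set.Ioi 0)) (nhds t) := by
  have hid : Filter.Tendsto (fun h : ℝ => t - h) (nhdsWithin 0 (Set.Ioi 0)) (nhds t) := by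
    have : Filter.Tendsto (fun h : ℝ => t - h) (nhds 0) (nhds (t - 0)) :=
      (continuous_const.sub continuous_id).tendsto 0
    rw [sub_zero] at this
    exact this.mono_left nhdsWithin_le_nhds
  refine tendsto_of_tendsto_of_tendsto_of_le_of_le' hid tendsto_const_nhds ?_ ?_
  · filter_upwards [self_mem_nhdsWithin] with h hh
    linarith [(floor_div_mul_mem hh ht).2]
  · filter_upwards [self_mem_nhdsWithin] with h hh
    linarith [(floor_div_mul_mem hh ht).1]

theorem eventually_floor_div_lt {s t : ℝ} (hs : 0 ≤ s) (hst : s < t) :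
    ∀ᶠ h : ℝ in nhdsWithin 0 (Set.Ioi 0), ⌊s / h⌋₊ < ⌊t / h⌋₊ := by
  filter_upwards [Ioo_mem_nhdsGT (sub_pos.2 hst)] with h hh
  have h0 : 0 < h := hh.1
  rw [← Nat.succ_le_iff, Nat.succ_eq_add_one, ← Nat.floor_add_one (div_nonneg hs h0.le)]
  apply Nat.floor_le_floor
  rw [div_add_one h0.ne', div_le_div_iff_of_pos_right h0]
  linarith [hh.2]

theorem monotone_floor_div {h : ℝ} (hh : 0 ≤ h) :
    Monotone fun s : Set.Ioi (0 : ℝ) => ⌊(s : ℝ) / h⌋₊ :=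
  fun _ _ hst => Nat.floor_le_floor (div_le_div_of_nonneg_right hst hh)

end Sampling

/-! ### Transfer of the state, observability and controllability operators. -/

section Operators

variable {n : ℕ} {k : ℕ∞} {A : Matrix (Fin n) (Fin n) ℝ} {b c : Fin n → ℝ}

theorem isOVD_mulVec_pow (h : IsOVD k Set.univ fun x : Fin n → ℝ => A *ᵥ x) (N : ℕ) :
    IsOVD k Set.univ fun x : Fin n → ℝ => (A ^ N) *ᵥ x := by
  induction N with
  | zero =>
    refine fun u _ _ => ⟨by simp, fun _ σ τ hσ hτ => ?_⟩
    simp only [pow_zero, Matrix.one_mulVec] at hτ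
    exact hσ.unique hτ
  | succ N ih =>
    have := ih.comp h (by simp) (by simp)
    simpa only [Matrix.mulVec_mulVec, ← pow_succ] using this

theorem isOVD_dtObs_iff : IsOVD k Set.univ (dtObs A c) ↔
    ∀ u, ∀ m : ℕ, (m : ℕ∞) ≤ k → variation u ≤ m → ∀ σ,
      Alternates (dtObs A c u) m σ → Alternates u m σ := by
  rw [isOVD_iff_alternates (by ext; simp [dtObs])
    fun u h => absurd h (variation_ne_top_of_fin u)]
  simp

theorem isOVD_ctObs_iff : IsOVD k Set.univ (ctObs A c) ↔
    ∀ u, ∀ m : ℕ, (m : ℕ∞) ≤ k → variation u ≤ m → ∀ σ,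
      Alternates (ctObs A c u) m σ → Alternates u m σ := by
  rw [isOVD_iff_alternates (by ext; simp [ctObs])
    fun u h => absurd h (variation_ne_top_of_fin u)]
  simp

theorem dtObs_exp_apply (h : ℝ) (x : Fin n → ℝ) (i : ℕ) :
    dtObs (NormedSpace.exp (h • A)) c x i =
      c ⬝ᵥ (NormedSpace.exp (((i : ℝ) * h) • A) *ᵥ x) := by
  rw [dtObs, exp_smul_pow]

theorem isOVD_dtObs_of_ctObs (H : IsOVD k Set.univ (ctObs A c)) {h : ℝ} (hh : 0 ≤ h) :
    IsOVD k Set.univ (dtObs (NormedSpace.exp (h • A)) c) := by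
  rw [isOVD_dtObs_iff]
  rw [isOVD_ctObs_iff] at H
  refine fun u m hm hum σ hσ => H u m hm hum σ (hσ.map
    (φ := fun i : ℕ => ⟨(i : ℝ) * h, mul_nonneg i.cast_nonneg hh⟩) (fun i j hij => ?_) fun j _ => ?_)
  · exact mul_le_mul_of_nonneg_right (Nat.cast_le.2 hij) hh
  · rw [dtObs_exp_apply, ctObs]

/-- A chain at times `t` is moved to the grid indices `⌊t/h⌋`. For small `h` these stay strictly
ordered, and continuity preserves the signs. -/
theorem isOVD_ctObs_of_dtObs
    (H : ∀ᶠ h : ℝ in nhdsWithin 0 (Set.Ioi 0),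
      IsOVD k Set.univ (dtObs (NormedSpace.exp (h • A)) c)) :
    IsOVD k Set.univ (ctObs A c) := by
  rw [isOVD_ctObs_iff]
  rintro u m hm hum σ ⟨hσ, t, ht⟩
  have hev := ht.eventually (G := fun h => dtObs (NormedSpace.exp (h • A)) c u)
    (l := nhdsWithin 0 (Set.Ioi 0)) (φ := fun h (t : Set.Ici (0 : ℝ)) => ⌊(t : ℝ) / h⌋₊)
    (fun s t hst => eventually_floor_div_lt (Set.mem_Ici.1 s.2) hst) (fun t => ?_) hσ
  · obtain ⟨h, h1, h2⟩ := (hev.and H).exists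
    exact isOVD_dtObs_iff.1 h2 u m hm hum σ ⟨hσ, _, h1⟩
  · simp only [dtObs_exp_apply]
    have hc : Continuous fun s : ℝ => c ⬝ᵥ (NormedSpace.exp (s • A) *ᵥ u) :=
      continuous_const.dotProduct (continuous_exp_smul_mulVec A u)
    exact (hc.tendsto (t : ℝ)).comp (tendsto_floor_div_mul t.2)

/-- The variation bound of maps into `ℝⁿ` passes to the limit. -/
theorem alternates_of_tendsto {ι κ α : Type*} [LinearOrder ι] [LinearOrder κ] {l : Filter α}
    [l.NeBot] {D : α → Set (κ → ℝ)} {X : α → (κ → ℝ) → (Fin n → ℝ)} {U : α → κ → ℝ} {u : ι → ℝ}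
    {v : Fin n → ℝ} (h0 : ∀ a, X a 0 = 0)
    (h : ∀ᶠ a in l, IsOVD k (D a) (X a) ∧ U a ∈ D a ∧
      ∀ m σ, Alternates (U a) m σ → Alternates u m σ)
    (hlim : Filter.Tendsto (fun a => X a (U a)) l (nhds v)) {m : ℕ} (hm : (m : ℕ∞) ≤ k)
    (hum : variation u ≤ m) {σ : SignType} (hσ : Alternates v m σ) : Alternates u m σ := by
  obtain ⟨a, ha, hX, hU, hsub⟩ := ((hσ.eventually hlim).and h).exists
  refine hsub m σ ((isOVD_iff_alternates (h0 a) fun _ _ => variation_ne_top_of_fin _).1 hX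
    (U a) hU m hm (variation_le_iff.2 fun τ hτ => ?_) σ ha)
  exact variation_le_iff.1 hum τ (hsub _ _ hτ)

/-- The lags `s` with `i h ≤ s < (i + 1) h`. -/
def lagCell (h : ℝ) (i : ℕ) : Set (Set.Ioi (0 : ℝ)) :=
  {s | ⌊(s : ℝ) / h⌋₊ = i}

theorem measurable_floor_lag (h : ℝ) :
    Measurable fun s : Set.Ioi (0 : ℝ) => ⌊(s : ℝ) / h⌋₊ :=
  (measurable_subtype_coe.div_const h).nat_floor

theorem measurableSet_lagCell (h : ℝ) (i : ℕ) : MeasurableSet (lagCell h i) :=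
  measurable_floor_lag h (measurableSet_singleton i)

theorem lagMeasure_lagCell_le {h : ℝ} (hh : 0 < h) (i : ℕ) :
    lagMeasure (lagCell h i) ≤ ENNReal.ofReal h := by
  rw [lagMeasure, (MeasurableEmbedding.subtype_coe measurableSet_Ioi).comap_apply]
  refine (measure_mono (t := Set.Icc ((i : ℝ) * h) (i * h + h)) ?_).trans (by simp)
  rintro _ ⟨s, hs, rfl⟩
  have hs' : ⌊(s : ℝ) / h⌋₊ = i := hs
  have := floor_div_mul_mem hh (le_of_lt s.2)
  rw [hs'] at this
  constructor <;> linarith [this.1, this.2]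

theorem lagCell_nonempty {h : ℝ} (hh : 0 < h) (i : ℕ) : (lagCell h i).Nonempty := by
  -- The midpoint works for every cell; the left end of cell `0` is not a positive lag.
  refine ⟨⟨((i : ℝ) + 1 / 2) * h, by simp only [Set.mem_Ioi]; positivity⟩, ?_⟩
  simp only [lagCell, Set.mem_ofPred_eq, mul_div_cancel_right₀ _ hh.ne']
  rw [Nat.floor_eq_iff (by positivity)]
  constructor <;> linarith

theorem exists_sign_eq_setIntegral {α : Type*} [MeasurableSpace α] {μ : Measure α} {s : Set α}
    (hs : MeasurableSet s) {f : α → ℝ} (h : ∫ x in s, f x ∂μ ≠ 0) :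
    ∃ x ∈ s, SignType.sign (f x) = SignType.sign (∫ x in s, f x ∂μ) := by
  by_contra! hne
  rcases lt_or_gt_of_ne h with h1 | h1
  · refine absurd (setIntegral_nonneg (μ := μ) hs fun x hx => ?_) (not_le.2 h1)
    by_contra! hx0
    exact hne x hx (by rw [sign_neg hx0, sign_neg h1])
  · refine absurd (setIntegral_nonpos (μ := μ) hs fun x hx => ?_) (not_le.2 h1)
    by_contra! hx0
    exact hne x hx (by rw [sign_pos hx0, sign_pos h1])

/-- A nonzero cell integral shares its sign with some value of `u` in the cell. Choosing one such
point per cell is monotone because the cells are ordered. -/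
theorem Alternates.of_setIntegral_lagCell {u : Set.Ioi (0 : ℝ) → ℝ} {h : ℝ} (hh : 0 < h) {m : ℕ}
    {σ : SignType} (H : Alternates (fun i => ∫ s in lagCell h i, u s ∂lagMeasure) m σ) :
    Alternates u m σ := by
  have hex : ∀ i, ∃ s ∈ lagCell h i, ∫ s in lagCell h i, u s ∂lagMeasure ≠ 0 →
      SignType.sign (u s) = SignType.sign (∫ s in lagCell h i, u s ∂lagMeasure) := by
    intro i
    by_cases h0 : ∫ s in lagCell h i, u s ∂lagMeasure = 0
    · exact (lagCell_nonempty hh i).imp fun s hs => ⟨hs, fun h => absurd h0 h⟩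
    · obtain ⟨s, hs, h1⟩ := exists_sign_eq_setIntegral (measurableSet_lagCell h i) h0
      exact ⟨s, hs, fun _ => h1⟩
  choose φ hφ hs using hex
  refine H.map (φ := φ) (fun i j hij => ?_) hs
  rcases hij.eq_or_lt with rfl | hij
  · exact le_rfl
  · by_contra! hlt
    have : ⌊(φ j : ℝ) / h⌋₊ ≤ ⌊(φ i : ℝ) / h⌋₊ := monotone_floor_div hh.le hlt.le
    have hi : ⌊(φ i : ℝ) / h⌋₊ = i := hφ i
    have hj : ⌊(φ j : ℝ) / h⌋₊ = j := hφ j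
    omega

/-- The state reached by sampling the kernel `e^{As} b` at the left ends of the cells. -/
theorem hasSum_setIntegral_lagCell {u : Set.Ioi (0 : ℝ) → ℝ} {h : ℝ}
    (hu : Integrable (fun s : Set.Ioi (0 : ℝ) =>
      u s • (NormedSpace.exp (((⌊(s : ℝ) / h⌋₊ : ℝ) * h) • A) *ᵥ b)) lagMeasure) :
    HasSum (fun i => (∫ s in lagCell h i, u s ∂lagMeasure) •
        ((NormedSpace.exp (h • A) ^ i) *ᵥ b))
      (∫ s : Set.Ioi (0 : ℝ), u s • (NormedSpace.exp (((⌊(s : ℝ) / h⌋₊ : ℝ) * h) • A) *ᵥ b)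
        ∂lagMeasure) := by
  have hU : ⋃ i, lagCell h i = Set.univ :=
    Set.eq_univ_of_forall fun s => Set.mem_iUnion.2 ⟨_, rfl⟩
  have hd : Pairwise (Function.onFun Disjoint (lagCell h)) := fun i j hij =>
    Set.disjoint_left.2 fun s hi hj => hij ((hi : _ = i).symm.trans hj)
  have := hasSum_integral_iUnion (μ := lagMeasure) (measurableSet_lagCell h) hd hu.integrableOn
  rw [hU, Measure.restrict_univ] at this
  refine Eq.mp (congrArg (fun f => HasSum f _) (funext fun i => ?_)) this
  rw [exp_smul_pow]
  refine Eq.trans ?_ (integral_smul_const _ _)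
  refine setIntegral_congr_fun (measurableSet_lagCell h i) fun s hs => ?_
  have hs' : ⌊(s : ℝ) / h⌋₊ = i := hs
  rw [hs']

/-- The sampled kernel is `e^{-rA} e^{As} b` with `0 ≤ r ≤ h ≤ 1`, so a bound for `e^{-rA}` on `[0,
1]` gives a majorant independent of `h`. -/
theorem exists_norm_sampled_le :
    ∃ K : ℝ, ∀ (u : Set.Ioi (0 : ℝ) → ℝ) (h : ℝ), h ∈ Set.Ioc (0 : ℝ) 1 → ∀ s : Set.Ioi (0 : ℝ),
      ‖u s • (NormedSpace.exp (((⌊(s : ℝ) / h⌋₊ : ℝ) * h) • A) *ᵥ b)‖ ≤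
        K * ‖u s • (NormedSpace.exp ((s : ℝ) • A) *ᵥ b)‖ := by
  obtain ⟨K, hK⟩ := exists_norm_exp_neg_smul_mulVec_le A
  refine ⟨K, fun u h hh s => ?_⟩
  have hr := floor_div_mul_mem hh.1 (le_of_lt s.2)
  have := hK _ ⟨hr.1, hr.2.trans hh.2⟩ (u s • (NormedSpace.exp ((s : ℝ) • A) *ᵥ b))
  rwa [Matrix.mulVec_smul, Matrix.mulVec_mulVec, ← exp_add_smul, neg_sub, sub_add_cancel] at this

theorem aestronglyMeasurable_sampled {u : Set.Ioi (0 : ℝ) → ℝ} (hu : Measurable u) (h : ℝ) :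
    AEStronglyMeasurable (fun s : Set.Ioi (0 : ℝ) =>
      u s • (NormedSpace.exp (((⌊(s : ℝ) / h⌋₊ : ℝ) * h) • A) *ᵥ b)) lagMeasure := by
  refine hu.aestronglyMeasurable.smul ?_
  refine ((continuous_exp_smul_mulVec A b).measurable.comp
    (g := fun r : ℝ => NormedSpace.exp (r • A) *ᵥ b) ?_).aestronglyMeasurable
  exact (measurable_from_nat.comp (measurable_floor_lag h)).mul_const h

theorem isOVD_ctCon_of_dtCon
    (H : ∀ᶠ h : ℝ in nhdsWithin 0 (Set.Ioi 0),
      IsOVD k (dtInputs (NormedSpace.exp (h • A)) b) (dtCon (NormedSpace.exp (h • A)) b)) :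
    IsOVD k (ctInputs A b) (ctCon A b) := by
  refine (isOVD_iff_alternates (by simp [ctCon]) fun _ _ => variation_ne_top_of_fin _).2 ?_
  rintro u ⟨hu, ⟨M, hM⟩, hint⟩ m hm hum σ hσ
  obtain ⟨K, hK⟩ := exists_norm_sampled_le (A := A) (b := b)
  have hsmall : ∀ᶠ h : ℝ in nhdsWithin 0 (Set.Ioi 0), h ∈ Set.Ioc (0 : ℝ) 1 :=
    Ioc_mem_nhdsGT one_pos
  have hsum : ∀ h ∈ Set.Ioc (0 : ℝ) 1, _ := fun h hh =>
    hasSum_setIntegral_lagCell (Integrable.mono' (hint.norm.const_mul K)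
      (aestronglyMeasurable_sampled (A := A) (b := b) hu h) (.of_forall (hK u h hh)))
  refine alternates_of_tendsto (l := nhdsWithin (0 : ℝ) (Set.Ioi 0))
    (D := fun h => dtInputs (NormedSpace.exp (h • A)) b)
    (X := fun h => dtCon (NormedSpace.exp (h • A)) b)
    (U := fun h i => ∫ s in lagCell h i, u s ∂lagMeasure)
    (fun h => by simp [dtCon]) ?_ ?_ hm hum hσ
  · filter_upwards [H, hsmall] with h hX hh
    refine ⟨hX, ⟨⟨M * h, fun i => ?_⟩, (hsum h hh).summable⟩,
      fun m σ => Alternates.of_setIntegral_lagCell hh.1⟩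
    have hle := lagMeasure_lagCell_le hh.1 i
    have hM0 : 0 ≤ M := (abs_nonneg _).trans (hM ⟨1, Set.mem_Ioi.2 one_pos⟩)
    refine (norm_setIntegral_le_of_norm_le_const (f := u) (hle.trans_lt ENNReal.ofReal_lt_top)
      fun s _ => hM s).trans (mul_le_mul_of_nonneg_left ?_ hM0)
    exact ENNReal.toReal_le_of_le_ofReal hh.1.le hle
  · have hlim := tendsto_integral_filter_of_dominated_convergence (μ := lagMeasure)
      (l := nhdsWithin (0 : ℝ) (Set.Ioi 0))
      (F := fun h s => u s • (NormedSpace.exp (((⌊(s : ℝ) / h⌋₊ : ℝ) * h) • A) *ᵥ b))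
      (f := fun s => u s • (NormedSpace.exp ((s : ℝ) • A) *ᵥ b))
      _ (.of_forall fun h => aestronglyMeasurable_sampled hu h)
      (hsmall.mono fun h hh => .of_forall (hK u h hh)) (hint.norm.const_mul K)
      (.of_forall fun s => (((continuous_exp_smul_mulVec A b).tendsto (s : ℝ)).comp
        (tendsto_floor_div_mul (le_of_lt s.2))).const_smul (u s))
    refine hlim.congr' ?_
    filter_upwards [hsmall] with h hh
    exact (hsum h hh).tsum_eq.symm

/-- The first `N` samples of `u`, each spread over a pulse of width `δ` and unit area. -/
noncomputable def pulseTrain (u : ℕ → ℝ) (N : ℕ) (h δ : ℝ) (s : Set.Ioi (0 : ℝ)) : ℝ :=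
  ∑ i ∈ Finset.range N,
    (Set.Ioc ((i : ℝ) * h) (i * h + δ)).indicator (fun _ => δ⁻¹ * u i) (s : ℝ)

theorem sign_pulseTrain {u : ℕ → ℝ} {N : ℕ} {h δ : ℝ} (hδ : 0 < δ) (hδh : δ < h)
    {s : Set.Ioi (0 : ℝ)} (hs : pulseTrain u N h δ s ≠ 0) :
    SignType.sign (u ⌊(s : ℝ) / h⌋₊) = SignType.sign (pulseTrain u N h δ s) := by
  have hh := hδ.trans hδh
  have hfl : ∀ i : ℕ, (s : ℝ) ∈ Set.Ioc ((i : ℝ) * h) (i * h + δ) → ⌊(s : ℝ) / h⌋₊ = i := by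
    -- Since `δ < h`, even the right end of the pulse lies in the cell `[ih, (i+1)h)`, so the pulses
    -- are disjoint.
    intro i hi
    rw [Nat.floor_eq_iff (div_nonneg (le_of_lt s.2) hh.le), le_div_iff₀ hh, div_lt_iff₀ hh]
    constructor <;> linarith [hi.1, hi.2]
  obtain ⟨i, hi, hne⟩ := Finset.exists_ne_zero_of_sum_ne_zero hs
  have hmem := Set.mem_of_indicator_ne_zero hne
  have : pulseTrain u N h δ s = δ⁻¹ * u i := by
    rw [pulseTrain, Finset.sum_eq_single_of_mem i hi, Set.indicator_of_mem hmem]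
    intro j _ hj
    exact Set.indicator_of_notMem (fun hmem' => hj ((hfl j hmem').symm.trans (hfl i hmem))) _
  rw [this, hfl i hmem, sign_mul, sign_pos (inv_pos.2 hδ), one_mul]

theorem integrable_and_integral_pulse (a : ℝ) (ha : 0 ≤ a) {δ : ℝ} (hδ : 0 ≤ δ) (r : ℝ) :
    Integrable (fun s : Set.Ioi (0 : ℝ) => (Set.Ioc a (a + δ)).indicator (fun _ => r) (s : ℝ) •
        (NormedSpace.exp ((s : ℝ) • A) *ᵥ b)) lagMeasure ∧
      ∫ s : Set.Ioi (0 : ℝ), (Set.Ioc a (a + δ)).indicator (fun _ => r) (s : ℝ) •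
        (NormedSpace.exp ((s : ℝ) • A) *ᵥ b) ∂lagMeasure =
      r • ∫ s in a..a + δ, NormedSpace.exp (s • A) *ᵥ b := by
  have hcont := (continuous_exp_smul_mulVec A b).const_smul r
  have e : (fun s : ℝ => (Set.Ioc a (a + δ)).indicator (fun _ => r) s •
      (NormedSpace.exp (s • A) *ᵥ b)) =
      (Set.Ioc a (a + δ)).indicator fun s => r • (NormedSpace.exp (s • A) *ᵥ b) := by
    ext1 s
    by_cases hs : s ∈ Set.Ioc a (a + δ) <;> simp [hs]
  have hI : Integrable (fun s : ℝ => (Set.Ioc a (a + δ)).indicator (fun _ => r) s •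
      (NormedSpace.exp (s • A) *ᵥ b)) := by
    rw [e, integrable_indicator_iff measurableSet_Ioc]
    exact hcont.integrableOn_Ioc
  constructor
  · exact (integrableOn_iff_comap_subtypeVal measurableSet_Ioi).1 hI.integrableOn
  · refine (integral_subtype_comap measurableSet_Ioi fun s : ℝ =>
      (Set.Ioc a (a + δ)).indicator (fun _ => r) s • (NormedSpace.exp (s • A) *ᵥ b)).trans ?_
    rw [e, setIntegral_indicator measurableSet_Ioc, Set.inter_eq_self_of_subset_right
      (Set.Ioc_subset_Ioi_self.trans (Set.Ioi_subset_Ioi ha)), integral_smul,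
      intervalIntegral.integral_of_le (by linarith)]

theorem integrable_pulseTrain (u : ℕ → ℝ) (N : ℕ) {h δ : ℝ} (hh : 0 ≤ h) (hδ : 0 ≤ δ) :
    Integrable (fun s : Set.Ioi (0 : ℝ) =>
      pulseTrain u N h δ s • (NormedSpace.exp ((s : ℝ) • A) *ᵥ b)) lagMeasure := by
  simp only [pulseTrain, Finset.sum_smul]
  exact integrable_finsetSum _ fun i _ =>
    (integrable_and_integral_pulse _ (mul_nonneg i.cast_nonneg hh) hδ _).1

theorem ctCon_pulseTrain (u : ℕ → ℝ) (N : ℕ) {h δ : ℝ} (hh : 0 ≤ h) (hδ : 0 ≤ δ) :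
    ctCon A b (pulseTrain u N h δ) = ∑ i ∈ Finset.range N,
      (u i) • δ⁻¹ • ∫ s in ((i : ℝ) * h)..(i * h + δ), NormedSpace.exp (s • A) *ᵥ b := by
  simp only [ctCon, pulseTrain, Finset.sum_smul]
  rw [integral_finsetSum _ fun i _ =>
    (integrable_and_integral_pulse _ (mul_nonneg i.cast_nonneg hh) hδ _).1]
  refine Finset.sum_congr rfl fun i _ => ?_
  rw [(integrable_and_integral_pulse _ (mul_nonneg i.cast_nonneg hh) hδ _).2, smul_smul, mul_comm]

theorem pulseTrain_mem_ctInputs (u : ℕ → ℝ) (N : ℕ) {h δ : ℝ} (hh : 0 ≤ h) (hδ : 0 ≤ δ) :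
    pulseTrain u N h δ ∈ ctInputs A b := by
  refine ⟨?_, ⟨∑ i ∈ Finset.range N, |δ⁻¹ * u i|, fun s => ?_⟩, integrable_pulseTrain u N hh hδ⟩
  · refine Finset.measurable_sum _ fun i _ => ?_
    exact (measurable_const.indicator measurableSet_Ioc).comp measurable_subtype_coe
  · refine (Finset.abs_sum_le_sum_abs _ _).trans (Finset.sum_le_sum fun i _ => ?_)
    exact norm_indicator_le_norm_self (fun _ => δ⁻¹ * u i) (s : ℝ)

theorem tendsto_ctCon_pulseTrain (u : ℕ → ℝ) (N : ℕ) {h : ℝ} (hh : 0 ≤ h) :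
    Filter.Tendsto (fun δ => ctCon A b (pulseTrain u N h δ)) (nhdsWithin 0 (Set.Ioi 0))
      (nhds (∑ i ∈ Finset.range N, u i • ((NormedSpace.exp (h • A) ^ i) *ᵥ b))) := by
  have hlim : Filter.Tendsto (fun δ : ℝ => ∑ i ∈ Finset.range N,
      (u i) • δ⁻¹ • ∫ s in ((i : ℝ) * h)..(i * h + δ), NormedSpace.exp (s • A) *ᵥ b)
      (nhdsWithin 0 (Set.Ioi 0))
      (nhds (∑ i ∈ Finset.range N, u i • ((NormedSpace.exp (h • A) ^ i) *ᵥ b))) := by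
    refine tendsto_finsetSum _ fun i _ => Filter.Tendsto.const_smul ?_ _
    -- The mean of the kernel over a shrinking pulse is a difference quotient of its primitive.
    have hd := ((continuous_exp_smul_mulVec A b).integral_hasStrictDerivAt
      ((i : ℝ) * h) ((i : ℝ) * h)).hasDerivAt.tendsto_slope_zero_right
    simpa only [intervalIntegral.integral_same, sub_zero, exp_smul_pow] using hd
  refine hlim.congr' ?_
  filter_upwards [self_mem_nhdsWithin] with δ hδ
  exact (ctCon_pulseTrain u N hh (le_of_lt hδ)).symm

theorem isOVD_dtCon_of_ctCon (H : IsOVD k (ctInputs A b) (ctCon A b)) {h : ℝ} (hh : 0 < h) :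
    IsOVD k (dtInputs (NormedSpace.exp (h • A)) b) (dtCon (NormedSpace.exp (h • A)) b) := by
  refine (isOVD_iff_alternates (by simp [dtCon]) fun _ _ => variation_ne_top_of_fin _).2 ?_
  rintro u ⟨-, hsum⟩ m hm hum σ hσ
  -- Some partial sum already shows the pattern, so finitely many pulses suffice.
  obtain ⟨N, hN⟩ := (hσ.eventually hsum.hasSum.tendsto_sum_nat).exists
  refine alternates_of_tendsto (l := nhdsWithin (0 : ℝ) (Set.Ioi 0))
    (D := fun _ => ctInputs A b) (X := fun _ => ctCon A b) (U := fun δ => pulseTrain u N h δ)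
    (fun _ => by simp [ctCon]) ?_ (tendsto_ctCon_pulseTrain u N hh.le) hm hum hN
  filter_upwards [Ioo_mem_nhdsGT hh] with δ hδ
  exact ⟨H, pulseTrain_mem_ctInputs u N hh.le hδ.1.le, fun m σ hσ =>
    hσ.map (monotone_floor_div hh.le) fun s hs => sign_pulseTrain hδ.1 hδ.2 hs⟩

end Operators

/-! ### The equivalence. -/

theorem mainTheorem8 {n : ℕ} (k : ℕ∞) (hk : 1 ≤ k) (A : Matrix (Fin n) (Fin n) ℝ)
    (b c : Fin n → ℝ) :
    CTInternallyHankelPositive k A b c ↔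
      ∃ ε : ℝ, 0 < ε ∧ ∀ h ∈ Set.Ioo (0 : ℝ) ε,
        DTInternallyHankelPositive k (NormedSpace.exp (h • A)) b c := by
  constructor
  · rintro ⟨h1, h2, h3⟩
    -- The choice `1` is arbitrary: every `h > 0` works in this direction.
    exact ⟨1, one_pos, fun h hh => ⟨h1 h hh.1.le, isOVD_dtCon_of_ctCon h2 hh.1,
      isOVD_dtObs_of_ctObs h3 hh.1.le⟩⟩
  · rintro ⟨ε, hε, H⟩
    have hev : ∀ᶠ h : ℝ in nhdsWithin 0 (Set.Ioi 0),
        DTInternallyHankelPositive k (NormedSpace.exp (h • A)) b c :=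
      Filter.mem_of_superset (Ioo_mem_nhdsGT hε) H
    refine ⟨fun t ht => ?_, isOVD_ctCon_of_dtCon (hev.mono fun h hh => hh.2.1),
      isOVD_ctObs_of_dtObs (hev.mono fun h hh => hh.2.2)⟩
    rcases ht.eq_or_lt with rfl | ht
    -- At `t = 0` the map is the identity, the zeroth power of any admissible step matrix.
    · simpa using isOVD_mulVec_pow (H (ε / 2) ⟨half_pos hε, half_lt_self hε⟩).1 0
    · obtain ⟨N, hN⟩ := exists_nat_gt (t / ε)
      have hN0 : (0 : ℝ) < N := (div_pos ht hε).trans hN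
      have hlt : t / N < ε := by
        rw [div_lt_iff₀ hε] at hN
        rw [div_lt_iff₀ hN0]
        linarith
      have := isOVD_mulVec_pow (H (t / N) ⟨div_pos ht hN0, hlt⟩).1 N
      rwa [exp_smul_pow, mul_div_cancel₀ _ hN0.ne'] at this
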